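/- Let $\eta$ be an integrable random vector in $\mathbb{R}^d$ with $\mathbb{E}\eta=0$. For $S\subseteq\mathbb{R}^d$ define the width $$\mathcal{W}(S)=\mathbb{E}\max_{s\in S}\langle s,\eta\rangle\in[-\infty,\infty],$$ where $\max$ is understood as a supremum and the maximum over the empty set is $-\infty$ (so $\mathcal{W}(\emptyset)=-\infty$). Then: (1) $\mathcal{W}(S)\ge 0$ for every nonempty $S\subseteq\mathbb{R}^d$; $\mathcal{W}(S)\le\mathcal{W}(T)$ whenever $S\subseteq T\subseteq\mathbb{R}^d$; and $\mathcal{W}(S\cup T)+\mathcal{W}(S\cap T)\le\mathcal{W}(S)+\mathcal{W}(T)$ for all $S,T\subseteq\mathbb{R}^d$ (with $\infty+(-\infty)=-\infty$). If $S$ is nonempty and bounded, then $\max_{s\in S}\langle s,\eta\rangle$ is integrable, so $\mathcal{W}(S)$ is a finite real number. (2) Suppose that $\eta\sim\mathcal{N}(0,I_d)$, let $k\ge 1$, and let $\eta_1,\ldots,\eta_k\sim\mathcal{N}(0,I_d)$ be independent. Then for every nonempty bounded $S\subset\mathbb{R}^d$ and every $\delta\in(0,1]$, with probability at least $1-\delta$,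 $$\left|\frac1k\sum_{j=1}^k\max_{s\in S}\langle s,\eta_j\rangle-\mathcal{W}(S)\right|\le D(S)\sqrt{\frac{2\log(2/\delta)}{k}},\qquad D(S)=\sup_{s\in S}\|s\|.$$ If moreover $0$ lies in the convex hull of $S$, the same holds with $D(S)$ replaced by the diameter $\mathrm{diam}(S)=\sup_{s,t\in S}\|s-t\|$. -/

import Mathlib

open MeasureTheory ProbabilityTheory
open scoped ENNReal

/-- The maximum (supremum) of `⟨s, x⟩` over `s ∈ S`, as an extended real number, for an arbitrary
set `S`. It is `-∞` for the empty set and may be `+∞` for an unbounded one. -/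
noncomputable def eMaxInner {d : ℕ} (S : Set (EuclideanSpace ℝ (Fin d)))
    (x : EuclideanSpace ℝ (Fin d)) : EReal :=
  ⨆ s ∈ S, ((inner ℝ s x : ℝ) : EReal)

/-- The same maximum as a real number, for use when `S` is nonempty and bounded. -/
noncomputable def maxInner {d : ℕ} (S : Set (EuclideanSpace ℝ (Fin d)))
    (x : EuclideanSpace ℝ (Fin d)) : ℝ :=
  sSup ((fun s => inner ℝ s x) '' S)

/-- Expectation `E f⁺ - E f⁻` of an extended-real random variable. -/
noncomputable def eExpectation {Ω : Type*} [MeasurableSpace Ω] (P : Measure Ω)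
    (f : Ω → EReal) : EReal :=
  ((∫⁻ ω, (f ω).toENNReal ∂P : ℝ≥0∞) : EReal) - ((∫⁻ ω, (-f ω).toENNReal ∂P : ℝ≥0∞) : EReal)

/-- The width `W(S) = E max_{s ∈ S} ⟨s, η⟩` of a set `S` of vectors. -/
noncomputable def width {d : ℕ} {Ω : Type*} [MeasurableSpace Ω] (P : Measure Ω)
    (η : Ω → EuclideanSpace ℝ (Fin d)) (S : Set (EuclideanSpace ℝ (Fin d))) : EReal :=
  eExpectation P (fun ω => eMaxInner S (η ω))

/-- Submodularity of an extended-real set function. The sum `∞ + (-∞)` is `-∞`. -/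
def IsSubmodular {α : Type*} (f : Set α → EReal) : Prop :=
  ∀ S T : Set α, f (S ∪ T) + f (S ∩ T) ≤ f S + f T

/-- The largest norm `sup_{s ∈ S} ‖s‖` of an element of `S`: the least `D ≥ 0` such that
`⟨s, v⟩ ≤ D ‖v‖` for all `s ∈ S` and all `v`. -/
noncomputable def normRadius {d : ℕ} (S : Set (EuclideanSpace ℝ (Fin d))) : ℝ :=
  sSup ((fun s => ‖s‖) '' S)

/-! The order properties hold pointwise before expectations are taken. The maximum over `S ∪ T` is
the larger of the two maxima, the maximum over `S ∩ T` is at most the smaller, and max + min = sum.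
A single `s ∈ S` gives the integrable minorant `⟨s, η⟩`, of mean zero, so widths of nonempty sets
are nonnegative and no `∞ - ∞` occurs (`eExpectation_max_add_le`).

For concentration, the maximum over bounded `S` is a `D(S)`-Lipschitz function of the Gaussian
vector, and a `K`-Lipschitz function is sub-Gaussian with the sharp variance proxy `K ^ 2`
(`LipschitzWith.hasSubgaussianMGF_stdGaussian`). Independence and a two-sided Chernoff bound then
give the stated constant.

The sharp proxy comes from Prékopa–Leindler. Its Gaussian form tensorises
(`pi_gaussianReal_prekopa_leindler`) and is applied to `exp (-(t/s) G)` and `exp G`; Jensen turns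
the first integral into the mean of `G`, and letting `s → 1` gives `E exp G ≤ exp (K²/2 + E G)`. -/

/-! ### Brunn–Minkowski and Prékopa–Leindler on the line. -/

/-- One-dimensional Brunn–Minkowski inequality for compact sets. -/
theorem volume_add_le_of_isCompact {A B C : Set ℝ} (hA : IsCompact A) (hB : IsCompact B)
    (hA0 : A.Nonempty) (hB0 : B.Nonempty) (h : ∀ a ∈ A, ∀ b ∈ B, a + b ∈ C) :
    volume A + volume B ≤ volume C := by
  obtain ⟨m, hm, hmin⟩ := hB.exists_isLeast hB0
  obtain ⟨M, hM, hmax⟩ := hA.exists_isGreatest hA0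
  -- The translates `m + A` and `M + B` both lie in `C`. The first is to the left of `m + M` and the
  -- second to the right, so they meet only in that point.
  have hX : volume ((fun x => m + x) '' A) = volume A := by
    rw [Set.image_add_left, measure_preimage_add]
  have hY : volume ((fun x => M + x) '' B) = volume B := by
    rw [Set.image_add_left, measure_preimage_add]
  have hYm : MeasurableSet ((fun x => M + x) '' B) :=
    (hB.image (continuous_const.add continuous_id)).measurableSet
  rw [← hX, ← hY, ← measure_union₀ hYm.nullMeasurableSet]
  · refine measure_mono ?_
    rintro x (⟨a, ha, rfl⟩ | ⟨b, hb, rfl⟩)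
    · simpa [add_comm] using h a ha m hm
    · exact h M hM b hb
  · refine measure_mono_null (t := {m + M}) ?_ (measure_singleton _)
    rintro x ⟨⟨a, ha, rfl⟩, ⟨b, hb, hab⟩⟩
    have h1 := hmin hb
    have h2 := hmax ha
    simp only [Set.mem_singleton_iff] at *
    linarith

/-- One-dimensional Brunn–Minkowski inequality. -/
theorem volume_add_le {A B C : Set ℝ} (hA : MeasurableSet A) (hB : MeasurableSet B)
    (hA0 : A.Nonempty) (hB0 : B.Nonempty) (h : ∀ a ∈ A, ∀ b ∈ B, a + b ∈ C) :
    volume A + volume B ≤ volume C := by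
  obtain ⟨a₀, ha₀⟩ := hA0
  obtain ⟨b₀, hb₀⟩ := hB0
  have key : ∀ K ⊆ A, IsCompact K → ∀ L ⊆ B, IsCompact L → volume K + volume L ≤ volume C := by
    intro K hKA hK L hLB hL
    -- Adding the base points makes both compact sets nonempty, so `K` and `L` may be empty.
    refine (add_le_add (measure_mono (Set.subset_insert a₀ K))
      (measure_mono (Set.subset_insert b₀ L))).trans
      (volume_add_le_of_isCompact (hK.insert a₀) (hL.insert b₀) (Set.insert_nonempty _ _)
        (Set.insert_nonempty _ _) ?_)
    intro a ha b hb
    exact h a (Set.insert_subset ha₀ hKA ha) b (Set.insert_subset hb₀ hLB hb)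
  rw [hA.measure_eq_iSup_isCompact, hB.measure_eq_iSup_isCompact]
  simp only [iSup_and']
  refine ENNReal.biSup_add_biSup_le' (p := fun K => K ⊆ A ∧ IsCompact K)
    (q := fun K => K ⊆ B ∧ IsCompact K) ⟨∅, by simp⟩ ⟨∅, by simp⟩ ?_
  rintro K ⟨hKA, hK⟩ L ⟨hLB, hL⟩
  exact key K hKA hK L hLB hL

/-- Layer-cake formula for functions bounded by one. -/
theorem lintegral_eq_lintegral_Ioo_of_le_one {f : ℝ → ℝ≥0∞} (hf : Measurable f)
    (h1 : ∀ x, f x ≤ 1) :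
    ∫⁻ x, f x = ∫⁻ r in Set.Ioo (0 : ℝ) 1, volume {x | ENNReal.ofReal r < f x} := by
  have hfin : ∀ x, f x ≠ ∞ := fun x => ((h1 x).trans_lt ENNReal.one_lt_top).ne
  have e1 : ∫⁻ x, f x = ∫⁻ x, ENNReal.ofReal (f x).toReal := by
    simp only [ENNReal.ofReal_toReal (hfin _)]
  rw [e1, lintegral_eq_lintegral_meas_lt volume (ae_of_all _ fun x => ENNReal.toReal_nonneg)
    hf.ennreal_toReal.aemeasurable,
    ← Set.Ioo_union_Ici_eq_Ioi (zero_lt_one' ℝ),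
    lintegral_union measurableSet_Ici (Set.disjoint_left.2 fun x hx hx' => not_le.2 hx.2 hx')]
  have e2 : ∫⁻ r in Set.Ici (1 : ℝ), volume {x | r < (f x).toReal} = 0 := by
    rw [setLIntegral_congr_fun (g := fun _ => 0) measurableSet_Ici]
    · simp
    · intro r hr
      have : {x | r < (f x).toReal} = ∅ := by
        ext x
        have : (f x).toReal ≤ 1 := ENNReal.toReal_le_of_le_ofReal zero_le_one (by simpa using h1 x)
        simpa using this.trans hr
      simp [this]
  rw [e2, add_zero]
  refine setLIntegral_congr_fun measurableSet_Ioo fun r hr => ?_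
  congr 1
  ext x
  exact (ENNReal.ofReal_lt_iff_lt_toReal hr.1.le (hfin x)).symm

open scoped Pointwise in
/-- One-dimensional Prékopa–Leindler inequality for functions with supremum one. -/
theorem prekopa_leindler_of_iSup_eq_one {f g h : ℝ → ℝ≥0∞} (hf : Measurable f) (hg : Measurable g)
    (hh : Measurable h) (hf1 : ⨆ x, f x = 1) (hg1 : ⨆ x, g x = 1) {s t : ℝ} (hs : 0 < s)
    (ht : 0 < t) (hst : s + t = 1)
    (hfg : ∀ x y, f x ^ s * g y ^ t ≤ h (s * x + t * y)) :
    ENNReal.ofReal s * (∫⁻ x, f x) + ENNReal.ofReal t * ∫⁻ x, g x ≤ ∫⁻ x, h x := by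
  have hfle : ∀ x, f x ≤ 1 := fun x => hf1 ▸ le_iSup f x
  have hgle : ∀ x, g x ≤ 1 := fun x => hg1 ▸ le_iSup g x
  have hmeas : ∀ {u : ℝ → ℝ≥0∞},
      Measurable fun r : ℝ => volume {x | ENNReal.ofReal r < u x} := fun {u} =>
    Antitone.measurable fun a b hab => measure_mono fun x hx =>
      (ENNReal.ofReal_le_ofReal hab).trans_lt hx
  calc ENNReal.ofReal s * (∫⁻ x, f x) + ENNReal.ofReal t * ∫⁻ x, g x
      = ∫⁻ r in Set.Ioo (0 : ℝ) 1, (ENNReal.ofReal s * volume {x | ENNReal.ofReal r < f x} +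
          ENNReal.ofReal t * volume {x | ENNReal.ofReal r < g x}) := by
        rw [lintegral_eq_lintegral_Ioo_of_le_one hf hfle,
          lintegral_eq_lintegral_Ioo_of_le_one hg hgle,
          lintegral_add_left (hmeas.const_mul _), lintegral_const_mul _ hmeas,
          lintegral_const_mul _ hmeas]
    _ ≤ ∫⁻ r in Set.Ioo (0 : ℝ) 1, volume {x | ENNReal.ofReal r < min (h x) 1} := by
        -- For `r < 1` both superlevel sets are nonempty because the suprema are one, so
        -- Brunn–Minkowski applies to `s • {f > r}` and `t • {g > r}`, whose sum lies in `{h > r}`.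
        refine setLIntegral_mono hmeas fun r hr => ?_
        have hr1 : ENNReal.ofReal r < 1 := by simpa using hr.2
        obtain ⟨x₀, hx₀⟩ := lt_iSup_iff.1 (hf1 ▸ hr1)
        obtain ⟨y₀, hy₀⟩ := lt_iSup_iff.1 (hg1 ▸ hr1)
        have hvol : ∀ (c : ℝ) (_ : 0 < c) (A : Set ℝ),
            ENNReal.ofReal c * volume A = volume (c • A) := by
          intro c hc A
          rw [Measure.addHaar_smul]
          simp [abs_of_pos hc]
        rw [hvol s hs, hvol t ht]
        refine volume_add_le ((measurableSet_lt measurable_const hf).const_smul₀ s)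
          ((measurableSet_lt measurable_const hg).const_smul₀ t)
          (Set.Nonempty.smul_set ⟨x₀, hx₀⟩) (Set.Nonempty.smul_set ⟨y₀, hy₀⟩) ?_
        rintro _ ⟨x, hx, rfl⟩ _ ⟨y, hy, rfl⟩
        simp only [Set.mem_ofPred_eq, smul_eq_mul] at hx hy ⊢
        refine lt_min (lt_of_lt_of_le ?_ (hfg x y)) hr1
        calc ENNReal.ofReal r = ENNReal.ofReal r ^ s * ENNReal.ofReal r ^ t := by
              rw [← ENNReal.rpow_add_of_nonneg _ _ hs.le ht.le, hst, ENNReal.rpow_one]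
          _ < f x ^ s * g y ^ t :=
              ENNReal.mul_lt_mul (ENNReal.rpow_lt_rpow hx hs) (ENNReal.rpow_lt_rpow hy ht)
    _ = ∫⁻ x, min (h x) 1 :=
        (lintegral_eq_lintegral_Ioo_of_le_one (hh.min measurable_const)
          fun x => min_le_right _ _).symm
    _ ≤ ∫⁻ x, h x := lintegral_mono fun x => min_le_left _ _

/-- Weighted inequality between the geometric and arithmetic means. -/
theorem ENNReal.geom_mean_le_arith_mean_two (a b : ℝ≥0∞) {s t : ℝ} (hs : 0 < s) (ht : 0 < t)
    (hst : s + t = 1) : a ^ s * b ^ t ≤ ENNReal.ofReal s * a + ENNReal.ofReal t * b := by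
  have h := ENNReal.young_inequality (a ^ s) (b ^ t) (p := s⁻¹) (q := t⁻¹)
    (by rw [Real.holderConjugate_iff]; constructor
        · exact (one_lt_inv₀ hs).2 (by linarith)
        · simpa using hst)
  rw [← ENNReal.rpow_mul, ← ENNReal.rpow_mul, mul_inv_cancel₀ hs.ne', mul_inv_cancel₀ ht.ne',
    ENNReal.rpow_one, ENNReal.rpow_one, ENNReal.div_eq_inv_mul, ENNReal.div_eq_inv_mul,
    ENNReal.ofReal_inv_of_pos hs, ENNReal.ofReal_inv_of_pos ht, inv_inv, inv_inv] at h
  exact h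

/-- One-dimensional Prékopa–Leindler inequality for bounded functions. -/
theorem prekopa_leindler_of_iSup_ne_top {f g h : ℝ → ℝ≥0∞} (hf : Measurable f) (hg : Measurable g)
    (hh : Measurable h) (hf1 : ⨆ x, f x ≠ ∞) (hg1 : ⨆ x, g x ≠ ∞) {s t : ℝ} (hs : 0 < s)
    (ht : 0 < t) (hst : s + t = 1)
    (hfg : ∀ x y, f x ^ s * g y ^ t ≤ h (s * x + t * y)) :
    (∫⁻ x, f x) ^ s * (∫⁻ x, g x) ^ t ≤ ∫⁻ x, h x := by
  set a := ⨆ x, f x with ha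
  set b := ⨆ x, g x with hb
  rcases eq_or_ne a 0 with ha0 | ha0
  · have : ∀ x, f x = 0 := fun x => le_antisymm (ha0 ▸ le_iSup f x) bot_le
    simp [this, hs]
  rcases eq_or_ne b 0 with hb0 | hb0
  · have : ∀ x, g x = 0 := fun x => le_antisymm (hb0 ▸ le_iSup g x) bot_le
    simp [this, ht]
  have hc0 : a ^ s * b ^ t ≠ 0 :=
    mul_ne_zero (ENNReal.rpow_pos (pos_iff_ne_zero.2 ha0) hf1).ne'
      (ENNReal.rpow_pos (pos_iff_ne_zero.2 hb0) hg1).ne'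
  have hct : a ^ s * b ^ t ≠ ∞ :=
    ENNReal.mul_ne_top (ENNReal.rpow_ne_top_of_nonneg hs.le hf1)
      (ENNReal.rpow_ne_top_of_nonneg ht.le hg1)
  have hfac : ∀ u v : ℝ≥0∞, (a⁻¹ * u) ^ s * (b⁻¹ * v) ^ t = (a ^ s * b ^ t)⁻¹ * (u ^ s * v ^ t) := by
    intro u v
    rw [ENNReal.mul_rpow_of_nonneg _ _ hs.le, ENNReal.mul_rpow_of_nonneg _ _ ht.le,
      ENNReal.inv_rpow, ENNReal.inv_rpow, ENNReal.mul_inv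
        (Or.inr (ENNReal.rpow_ne_top_of_nonneg ht.le hg1))
        (Or.inl (ENNReal.rpow_ne_top_of_nonneg hs.le hf1))]
    ring
  -- After division by the suprema the arithmetic-mean bound is available; it dominates the
  -- geometric mean, which is homogeneous, so the normalising constants cancel.
  have key := prekopa_leindler_of_iSup_eq_one (hf.const_mul a⁻¹) (hg.const_mul b⁻¹)
    (hh.const_mul (a ^ s * b ^ t)⁻¹)
    (by rw [← ENNReal.mul_iSup, ENNReal.inv_mul_cancel ha0 hf1])
    (by rw [← ENNReal.mul_iSup, ENNReal.inv_mul_cancel hb0 hg1]) hs ht hst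
    (fun x y => by rw [hfac]; exact mul_le_mul_right (hfg x y) _)
  rw [lintegral_const_mul _ hf, lintegral_const_mul _ hg, lintegral_const_mul _ hh] at key
  have := (ENNReal.geom_mean_le_arith_mean_two _ _ hs ht hst).trans key
  rw [hfac] at this
  exact (ENNReal.mul_le_mul_iff_right (ENNReal.inv_ne_zero.2 hct) (ENNReal.inv_ne_top.2 hc0)).1 this

/-- Monotone convergence for truncations; it removes boundedness from Prékopa–Leindler. -/
theorem lintegral_eq_iSup_min_natCast {α : Type*} [MeasurableSpace α] (μ : Measure α)
    {f : α → ℝ≥0∞} (hf : Measurable f) : ∫⁻ x, f x ∂μ = ⨆ n : ℕ, ∫⁻ x, min (f x) n ∂μ := by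
  rw [← lintegral_iSup (fun n => hf.min measurable_const)
    (fun m n hmn x => min_le_min le_rfl (by exact_mod_cast hmn))]
  congr 1 with x
  rw [← inf_iSup_eq, ENNReal.iSup_natCast, inf_top_eq]

/-- One-dimensional Prékopa–Leindler inequality. -/
theorem prekopa_leindler {f g h : ℝ → ℝ≥0∞} (hf : Measurable f) (hg : Measurable g)
    (hh : Measurable h) {s t : ℝ} (hs : 0 < s) (ht : 0 < t) (hst : s + t = 1)
    (hfg : ∀ x y, f x ^ s * g y ^ t ≤ h (s * x + t * y)) :
    (∫⁻ x, f x) ^ s * (∫⁻ x, g x) ^ t ≤ ∫⁻ x, h x := by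
  have hpow : ∀ {r : ℝ} (_ : 0 < r) (u : ℕ → ℝ≥0∞), (⨆ n, u n) ^ r = ⨆ n, u n ^ r := fun hr u =>
    (ENNReal.orderIsoRpow _ hr).map_iSup u
  have hbdd : ∀ (u : ℝ → ℝ≥0∞) (n : ℕ), ⨆ x, min (u x) n ≠ ∞ := fun u n =>
    ((iSup_le fun x => min_le_right _ _).trans_lt (ENNReal.natCast_lt_top n)).ne
  rw [lintegral_eq_iSup_min_natCast volume hf, lintegral_eq_iSup_min_natCast volume hg, hpow hs,
    hpow ht, ENNReal.iSup_mul]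
  refine iSup_le fun n => ?_
  rw [ENNReal.mul_iSup]
  refine iSup_le fun m => ?_
  refine prekopa_leindler_of_iSup_ne_top (hf.min measurable_const) (hg.min measurable_const) hh
    (hbdd f n) (hbdd g m) hs ht hst fun x y => le_trans ?_ (hfg x y)
  exact mul_le_mul' (ENNReal.rpow_le_rpow (min_le_left _ _) hs.le)
    (ENNReal.rpow_le_rpow (min_le_left _ _) ht.le)

/-! ### Prékopa–Leindler for Gaussian measures. -/

/-- Functional form of the Prékopa–Leindler inequality for the Gaussian measure on the line. -/
theorem gaussianReal_prekopa_leindler {f g : ℝ → ℝ≥0∞} (hf : Measurable f) (hg : Measurable g)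
    {C : ℝ≥0∞} {s t : ℝ} (hs : 0 < s) (ht : 0 < t) (hst : s + t = 1)
    (hfg : ∀ x y, f x ^ s * g y ^ t ≤ C * ENNReal.ofReal (Real.exp (s * t / 2 * (x - y) ^ 2))) :
    (∫⁻ x, f x ∂gaussianReal 0 1) ^ s * (∫⁻ x, g x ∂gaussianReal 0 1) ^ t ≤ C := by
  have hφ : Measurable (gaussianPDF 0 1) := measurable_gaussianPDF 0 1
  have hint : ∀ {u : ℝ → ℝ≥0∞}, Measurable u →
      ∫⁻ x, u x ∂gaussianReal 0 1 = ∫⁻ x, gaussianPDF 0 1 x * u x := by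
    intro u hu
    rw [gaussianReal_of_var_ne_zero 0 one_ne_zero, lintegral_withDensity_eq_lintegral_mul _ hφ hu]
    rfl
  -- This is `s x² + t y² - (s x + t y)² = s t (x - y)²`, valid since `s + t = 1`.
  have hpdf : ∀ x y, gaussianPDF 0 1 x ^ s * gaussianPDF 0 1 y ^ t *
      ENNReal.ofReal (Real.exp (s * t / 2 * (x - y) ^ 2)) = gaussianPDF 0 1 (s * x + t * y) := by
    intro x y
    have hc : (0 : ℝ) < (√(2 * Real.pi * (1 : NNReal)))⁻¹ := by
      have := Real.pi_pos
      simp only [NNReal.coe_one, mul_one]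
      positivity
    set c := (√(2 * Real.pi * (1 : NNReal)))⁻¹ with hcdef
    have hp : ∀ z, gaussianPDF 0 1 z = ENNReal.ofReal (c * Real.exp (-z ^ 2 / 2)) := by
      intro z
      simp [gaussianPDF, gaussianPDFReal, hcdef]
    have hpow : ∀ z (r : ℝ), gaussianPDF 0 1 z ^ r =
        ENNReal.ofReal (c ^ r * Real.exp (-z ^ 2 / 2 * r)) := by
      intro z r
      rw [hp, ENNReal.ofReal_rpow_of_pos (by positivity), Real.mul_rpow hc.le (Real.exp_pos _).le,
        Real.exp_mul]
    rw [hpow, hpow, hp, ← ENNReal.ofReal_mul (by positivity), ← ENNReal.ofReal_mul (by positivity)]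
    congr 1
    calc c ^ s * Real.exp (-x ^ 2 / 2 * s) * (c ^ t * Real.exp (-y ^ 2 / 2 * t)) *
          Real.exp (s * t / 2 * (x - y) ^ 2)
        = c ^ s * c ^ t * (Real.exp (-x ^ 2 / 2 * s) * Real.exp (-y ^ 2 / 2 * t) *
          Real.exp (s * t / 2 * (x - y) ^ 2)) := by ring
      _ = c * Real.exp (-(s * x + t * y) ^ 2 / 2) := by
        rw [← Real.rpow_add hc, hst, Real.rpow_one, ← Real.exp_add, ← Real.exp_add]
        congr 2
        obtain rfl : s = 1 - t := by linarith
        ring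
  rw [hint hf, hint hg]
  refine (prekopa_leindler (h := fun x => C * gaussianPDF 0 1 x) (hφ.mul hf) (hφ.mul hg)
    (hφ.const_mul C) hs ht hst fun x y => ?_).trans ?_
  · rw [Pi.mul_apply, Pi.mul_apply, ENNReal.mul_rpow_of_nonneg _ _ hs.le, ENNReal.mul_rpow_of_nonneg _ _ ht.le, ← hpdf x y]
    calc _ = gaussianPDF 0 1 x ^ s * gaussianPDF 0 1 y ^ t * (f x ^ s * g y ^ t) := by ring
      _ ≤ gaussianPDF 0 1 x ^ s * gaussianPDF 0 1 y ^ t *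
          (C * ENNReal.ofReal (Real.exp (s * t / 2 * (x - y) ^ 2))) := mul_le_mul_right (hfg x y) _
      _ = _ := by ring
  · rw [lintegral_const_mul _ hφ, lintegral_gaussianPDF_eq_one 0 one_ne_zero, mul_one]

/-- Functional form of the Prékopa–Leindler inequality for a product of standard Gaussians. -/
theorem pi_gaussianReal_prekopa_leindler {s t : ℝ} (hs : 0 < s) (ht : 0 < t) (hst : s + t = 1) :
    ∀ (n : ℕ) {f g : (Fin n → ℝ) → ℝ≥0∞} (_ : Measurable f) (_ : Measurable g) {C : ℝ≥0∞}
    (_ : ∀ x y, f x ^ s * g y ^ t ≤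
      C * ENNReal.ofReal (Real.exp (s * t / 2 * ∑ i, (x i - y i) ^ 2))),
    (∫⁻ x, f x ∂Measure.pi fun _ => gaussianReal 0 1) ^ s *
      (∫⁻ x, g x ∂Measure.pi fun _ => gaussianReal 0 1) ^ t ≤ C
  | 0, f, g, hf, hg, C, hfg => by
    rw [Measure.pi_of_empty (fun _ : Fin 0 => gaussianReal 0 1) default, lintegral_dirac,
      lintegral_dirac]
    simpa using hfg default default
  | n + 1, f, g, hf, hg, C, hfg => by
    have hcons : Measurable fun p : ℝ × (Fin n → ℝ) => (Fin.cons p.1 p.2 : Fin (n + 1) → ℝ) := by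
      refine measurable_pi_iff.2 fun i => ?_
      refine Fin.cases ?_ (fun j => ?_) i
      · simpa using measurable_fst
      · simpa [Function.comp_def] using (measurable_pi_apply j).comp measurable_snd
    have hsplit : ∀ {u : (Fin (n + 1) → ℝ) → ℝ≥0∞}, Measurable u →
        ∫⁻ x, u x ∂Measure.pi (fun _ => gaussianReal 0 1) =
        ∫⁻ a, ∫⁻ x, u (Fin.cons a x) ∂Measure.pi (fun _ => gaussianReal 0 1) ∂gaussianReal 0 1 := by
      intro u hu
      have h := (measurePreserving_piFinSuccAbove (fun _ : Fin (n + 1) => gaussianReal 0 1) 0).symm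
      rw [← h.lintegral_comp hu, lintegral_prod (fun p => u _) (hu.comp h.measurable).aemeasurable]
      simp [MeasurableEquiv.piFinSuccAbove, Fin.insertNthEquiv]
    rw [hsplit hf, hsplit hg]
    -- For fixed first coordinates `a`, `b` the induction hypothesis is used with constant `C * exp
    -- (s t (a - b)² / 2)`, which is exactly the one-dimensional hypothesis for the section
    -- integrals.
    refine gaussianReal_prekopa_leindler
      ((hf.comp hcons).lintegral_prod_right') ((hg.comp hcons).lintegral_prod_right')
      hs ht hst fun a b => ?_
    refine pi_gaussianReal_prekopa_leindler hs ht hst n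
      (hf.comp (hcons.comp measurable_prodMk_left)) (hg.comp (hcons.comp measurable_prodMk_left))
      fun x y => (hfg (Fin.cons a x) (Fin.cons b y)).trans_eq ?_
    rw [Fin.sum_univ_succ]
    simp only [Fin.cons_zero, Fin.cons_succ]
    rw [mul_add, Real.exp_add, ENNReal.ofReal_mul (Real.exp_pos _).le, mul_assoc]

/-! ### Exponential moments of Lipschitz functions of Gaussians. -/

/-- Jensen's inequality for the exponential, without an integrability condition on the
exponential. -/
theorem ofReal_exp_integral_le_lintegral {α : Type*} [MeasurableSpace α] {μ : Measure α}
    [IsProbabilityMeasure μ] {u : α → ℝ} (hu : Integrable u μ) :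
    ENNReal.ofReal (Real.exp (∫ x, u x ∂μ)) ≤ ∫⁻ x, ENNReal.ofReal (Real.exp (u x)) ∂μ := by
  by_cases h : Integrable (fun x => Real.exp (u x)) μ
  · rw [← ofReal_integral_eq_lintegral_ofReal h (ae_of_all _ fun x => (Real.exp_pos _).le)]
    exact ENNReal.ofReal_le_ofReal (convexOn_exp.map_integral_le
      Real.continuous_exp.continuousOn isClosed_univ (ae_of_all _ fun _ => Set.mem_univ _) hu h)
  · have : ∫⁻ x, ENNReal.ofReal (Real.exp (u x)) ∂μ = ∞ := by
      by_contra hne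
      refine h ⟨Real.continuous_exp.comp_aestronglyMeasurable hu.aestronglyMeasurable, ?_⟩
      rw [hasFiniteIntegral_iff_ofReal (ae_of_all _ fun x => (Real.exp_pos _).le)]
      exact lt_top_iff_ne_top.2 hne
    simp [this]

/-- Bound on the exponential moment of a Lipschitz function of independent standard Gaussians,
with a constant depending on the Prékopa–Leindler weights. -/
theorem lintegral_exp_pi_gaussianReal_le_of_weights {n : ℕ} {G : (Fin n → ℝ) → ℝ}
    (hG : Measurable G) (hint : Integrable G (Measure.pi fun _ => gaussianReal 0 1)) {K : ℝ}
    (hK : ∀ x y, G y - G x ≤ K * √(∑ i, (x i - y i) ^ 2)) {s t : ℝ} (hs : 0 < s) (ht : 0 < t)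
    (hst : s + t = 1) :
    ∫⁻ x, ENNReal.ofReal (Real.exp (G x)) ∂Measure.pi (fun _ => gaussianReal 0 1) ≤
      ENNReal.ofReal
        (Real.exp (K ^ 2 / (2 * s) + ∫ x, G x ∂Measure.pi (fun _ => gaussianReal 0 1))) := by
  set μ : Measure (Fin n → ℝ) := Measure.pi fun _ => gaussianReal 0 1
  set m := ∫ x, G x ∂μ
  have hpow : ∀ u r : ℝ, ENNReal.ofReal (Real.exp u) ^ r = ENNReal.ofReal (Real.exp (u * r)) :=
    fun u r => by rw [ENNReal.ofReal_rpow_of_pos (Real.exp_pos _), Real.exp_mul]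
  -- The exponent `-(t/s)` makes `f x ^ s * g y ^ t = exp (t (G y - G x))`. The constant comes from
  -- completing the square: `t K r ≤ t K² / (2s) + s t r² / 2`.
  have key := pi_gaussianReal_prekopa_leindler hs ht hst n
    (f := fun x => ENNReal.ofReal (Real.exp (-(t / s) * G x)))
    (g := fun x => ENNReal.ofReal (Real.exp (G x)))
    (C := ENNReal.ofReal (Real.exp (t * (K ^ 2 / (2 * s)))))
    (by fun_prop) (by fun_prop) (by
      intro x y
      rw [hpow, hpow, ← ENNReal.ofReal_mul (Real.exp_pos _).le,
        ← ENNReal.ofReal_mul (Real.exp_pos _).le, ← Real.exp_add, ← Real.exp_add]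
      refine ENNReal.ofReal_le_ofReal (Real.exp_le_exp.2 ?_)
      have hsq := Real.sq_sqrt (Finset.sum_nonneg fun i (_ : i ∈ Finset.univ) =>
        sq_nonneg (x i - y i))
      rw [← hsq]
      set r := √(∑ i, (x i - y i) ^ 2)
      have e1 : -(t / s) * G x * s + G y * t = t * (G y - G x) := by field_simp; ring
      have e2 : t * (K ^ 2 / (2 * s)) + s * t / 2 * r ^ 2 - t * (K * r) =
          t / (2 * s) * (K - s * r) ^ 2 := by field_simp; ring
      have e3 : 0 ≤ t / (2 * s) * (K - s * r) ^ 2 := by positivity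
      have e4 := mul_le_mul_of_nonneg_left (hK x y) ht.le
      linarith)
  have hJ := ofReal_exp_integral_le_lintegral (hint.const_mul (-(t / s)))
  rw [integral_const_mul] at hJ
  have hI : (∫⁻ x, ENNReal.ofReal (Real.exp (G x)) ∂μ) ^ t ≤
      ENNReal.ofReal (Real.exp (K ^ 2 / (2 * s) + m)) ^ t := by
    have h1 := (mul_le_mul_left (ENNReal.rpow_le_rpow hJ hs.le)
      ((∫⁻ x, ENNReal.ofReal (Real.exp (G x)) ∂μ) ^ t)).trans key
    have h2 := mul_le_mul_right h1 (ENNReal.ofReal (Real.exp (t * m)))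
    rw [hpow, ← mul_assoc, ← ENNReal.ofReal_mul (Real.exp_pos _).le, ← Real.exp_add,
      ← ENNReal.ofReal_mul (Real.exp_pos _).le, ← Real.exp_add] at h2
    have e1 : t * m + -(t / s) * m * s = 0 := by field_simp; ring
    have e2 : t * m + t * (K ^ 2 / (2 * s)) = (K ^ 2 / (2 * s) + m) * t := by ring
    rw [hpow, ← e2]
    change ENNReal.ofReal (Real.exp (t * m + -(t / s) * m * s)) * _ ≤ _ at h2
    rwa [e1, Real.exp_zero, ENNReal.ofReal_one, one_mul] at h2
  exact (ENNReal.rpow_le_rpow_iff ht).1 hI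

/-- Sharp bound on the exponential moment of a Lipschitz function of independent standard
Gaussians. -/
theorem lintegral_exp_pi_gaussianReal_le {n : ℕ} {G : (Fin n → ℝ) → ℝ}
    (hG : Measurable G) (hint : Integrable G (Measure.pi fun _ => gaussianReal 0 1)) {K : ℝ}
    (hK : ∀ x y, G y - G x ≤ K * √(∑ i, (x i - y i) ^ 2)) :
    ∫⁻ x, ENNReal.ofReal (Real.exp (G x)) ∂Measure.pi (fun _ => gaussianReal 0 1) ≤
      ENNReal.ofReal
        (Real.exp (K ^ 2 / 2 + ∫ x, G x ∂Measure.pi (fun _ => gaussianReal 0 1))) := by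
  have hlim : Filter.Tendsto (fun s : ℝ => ENNReal.ofReal (Real.exp (K ^ 2 / (2 * s) +
      ∫ x, G x ∂Measure.pi (fun _ => gaussianReal 0 1)))) (nhdsWithin 1 (Set.Iio 1))
      (nhds (ENNReal.ofReal (Real.exp (K ^ 2 / (2 * 1) +
        ∫ x, G x ∂Measure.pi (fun _ => gaussianReal 0 1))))) := by
    refine Filter.Tendsto.mono_left ?_ nhdsWithin_le_nhds
    refine ENNReal.tendsto_ofReal ((Real.continuous_exp.tendsto _).comp ?_)
    refine Filter.Tendsto.add_const _ (tendsto_const_nhds.div ?_ (by norm_num))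
    exact (continuous_const.mul continuous_id).tendsto _
  rw [mul_one] at hlim
  -- The weight `s` must stay below one because `t = 1 - s` has to be positive, so the sharp
  -- constant is reached only in the limit.
  refine ge_of_tendsto hlim ?_
  filter_upwards [Ioo_mem_nhdsLT (zero_lt_one' ℝ)] with s hs
  exact lintegral_exp_pi_gaussianReal_le_of_weights hG hint hK hs.1 (sub_pos.2 hs.2)
    (add_sub_cancel s 1)

/-- Lipschitz functions grow at most linearly, and a Gaussian has a first moment. -/
theorem LipschitzWith.integrable_stdGaussian {d : ℕ} {F : EuclideanSpace ℝ (Fin d) → ℝ}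
    {K : NNReal} (hF : LipschitzWith K F) :
    Integrable F (stdGaussian (EuclideanSpace ℝ (Fin d))) := by
  have hid : Integrable (fun x : EuclideanSpace ℝ (Fin d) => x)
    (stdGaussian (EuclideanSpace ℝ (Fin d))) := IsGaussian.integrable_fun_id
  refine ((integrable_const ‖F 0‖).add (hid.norm.const_mul (K : ℝ))).mono'
    hF.continuous.aestronglyMeasurable (ae_of_all _ fun x => ?_)
  have h := hF.dist_le_mul x 0
  rw [dist_zero_right, dist_eq_norm] at h
  have := norm_add_le (F x - F 0) (F 0)
  rw [sub_add_cancel] at this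
  simp only [Pi.add_apply]
  linarith

theorem LipschitzWith.lintegral_exp_stdGaussian_le {d : ℕ} {F : EuclideanSpace ℝ (Fin d) → ℝ}
    {K : NNReal} (hF : LipschitzWith K F) :
    ∫⁻ x, ENNReal.ofReal (Real.exp (F x)) ∂stdGaussian (EuclideanSpace ℝ (Fin d)) ≤
      ENNReal.ofReal (Real.exp ((K : ℝ) ^ 2 / 2 +
        ∫ x, F x ∂stdGaussian (EuclideanSpace ℝ (Fin d)))) := by
  have hmeas : Measurable (WithLp.toLp 2 : (Fin d → ℝ) → EuclideanSpace ℝ (Fin d)) := by fun_prop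
  have hint := hF.integrable_stdGaussian
  have hFm : Measurable F := hF.continuous.measurable
  rw [← map_pi_eq_stdGaussian] at hint ⊢
  rw [lintegral_map (by fun_prop) hmeas, integral_map hmeas.aemeasurable hFm.aestronglyMeasurable]
  refine lintegral_exp_pi_gaussianReal_le (hFm.comp hmeas) (hint.comp_measurable hmeas)
    fun x y => ?_
  have h := hF.dist_le_mul (WithLp.toLp 2 x) (WithLp.toLp 2 y)
  rw [EuclideanSpace.dist_eq, Real.dist_eq, abs_sub_comm] at h
  simp only [Real.dist_eq, sq_abs] at h
  exact (le_abs_self _).trans h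

/-- A Lipschitz function of a standard Gaussian vector is sub-Gaussian around its mean. -/
theorem LipschitzWith.hasSubgaussianMGF_stdGaussian {d : ℕ} {F : EuclideanSpace ℝ (Fin d) → ℝ}
    {K : NNReal} (hF : LipschitzWith K F) :
    HasSubgaussianMGF (fun x => F x - ∫ y, F y ∂stdGaussian (EuclideanSpace ℝ (Fin d))) (K ^ 2)
      (stdGaussian (EuclideanSpace ℝ (Fin d))) := by
  set m := ∫ y, F y ∂stdGaussian (EuclideanSpace ℝ (Fin d))
  have key : ∀ r : ℝ, ∫⁻ x, ENNReal.ofReal (Real.exp (r * (F x - m)))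
      ∂stdGaussian (EuclideanSpace ℝ (Fin d)) ≤
      ENNReal.ofReal (Real.exp ((K ^ 2 : NNReal) * r ^ 2 / 2)) := by
    intro r
    -- Scaling by `r` turns the single moment bound into the whole moment generating function; the
    -- centred function has mean zero.
    have hL : LipschitzWith (‖r‖₊ * K) fun x => r * (F x - m) := by
      refine LipschitzWith.of_dist_le_mul fun x y => ?_
      rw [Real.dist_eq, ← mul_sub, abs_mul, sub_sub_sub_cancel_right, NNReal.coe_mul, coe_nnnorm,
        Real.norm_eq_abs, mul_assoc]
      exact mul_le_mul_of_nonneg_left (hF.dist_le_mul x y) (abs_nonneg r)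
    refine hL.lintegral_exp_stdGaussian_le.trans_eq ?_
    rw [integral_const_mul, integral_sub hF.integrable_stdGaussian (integrable_const _)]
    congr 2
    simp [m, mul_pow]
    ring
  have hmeas : ∀ r : ℝ, Measurable fun x => Real.exp (r * (F x - m)) := fun r => by
    have := hF.continuous.measurable
    fun_prop
  have hint : ∀ r : ℝ, Integrable (fun x => Real.exp (r * (F x - m)))
      (stdGaussian (EuclideanSpace ℝ (Fin d))) := fun r =>
    ⟨(hmeas r).aestronglyMeasurable, by
      rw [hasFiniteIntegral_iff_ofReal (ae_of_all _ fun x => (Real.exp_pos _).le)]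
      exact (key r).trans_lt ENNReal.ofReal_lt_top⟩
  refine ⟨hint, fun r => ?_⟩
  rw [mgf, ← ENNReal.ofReal_le_ofReal_iff (Real.exp_pos _).le,
    ofReal_integral_eq_lintegral_ofReal (hint r) (ae_of_all _ fun x => (Real.exp_pos _).le)]
  exact key r

/-! ### Extended-real expectations and the order properties of the width. -/

theorem eMaxInner_mono {d : ℕ} {S T : Set (EuclideanSpace ℝ (Fin d))} (h : S ⊆ T)
    (x : EuclideanSpace ℝ (Fin d)) : eMaxInner S x ≤ eMaxInner T x :=
  biSup_mono h

theorem inner_le_eMaxInner {d : ℕ} {S : Set (EuclideanSpace ℝ (Fin d))}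
    {s : EuclideanSpace ℝ (Fin d)} (hs : s ∈ S) (x : EuclideanSpace ℝ (Fin d)) :
    ((inner ℝ s x : ℝ) : EReal) ≤ eMaxInner S x :=
  le_iSup₂ (f := fun s _ => ((inner ℝ s x : ℝ) : EReal)) s hs

theorem eMaxInner_union {d : ℕ} (S T : Set (EuclideanSpace ℝ (Fin d)))
    (x : EuclideanSpace ℝ (Fin d)) :
    eMaxInner (S ∪ T) x = max (eMaxInner S x) (eMaxInner T x) :=
  iSup_union

/-- `S` may be uncountable; a supremum of continuous functions is still lower semicontinuous. -/
theorem measurable_eMaxInner {d : ℕ} (S : Set (EuclideanSpace ℝ (Fin d))) :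
    Measurable (eMaxInner S) := by
  refine LowerSemicontinuous.measurable (lowerSemicontinuous_biSup fun s _ => ?_)
  exact (continuous_coe_real_ereal.comp
    (continuous_const.inner continuous_id)).lowerSemicontinuous

theorem EReal.toENNReal_monotone : Monotone EReal.toENNReal :=
  fun _ _ h => EReal.toENNReal_le_toENNReal h

theorem eExpectation_mono {Ω : Type*} [MeasurableSpace Ω] (P : Measure Ω) {f g : Ω → EReal}
    (h : ∀ ω, f ω ≤ g ω) : eExpectation P f ≤ eExpectation P g := by
  refine EReal.sub_le_sub (EReal.coe_ennreal_le_coe_ennreal_iff.2 (lintegral_mono fun ω => ?_))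
    (EReal.coe_ennreal_le_coe_ennreal_iff.2 (lintegral_mono fun ω => ?_))
  · exact EReal.toENNReal_monotone (h ω)
  · exact EReal.toENNReal_monotone (EReal.neg_le_neg_iff.2 (h ω))

theorem lintegral_ofReal_ne_top {Ω : Type*} [MeasurableSpace Ω] {P : Measure Ω} {f : Ω → ℝ}
    (hf : Integrable f P) : ∫⁻ ω, ENNReal.ofReal (f ω) ∂P ≠ ∞ :=
  ((lintegral_mono fun ω => Real.ofReal_le_enorm (f ω)).trans_lt hf.2).ne

/-- For an integrable real random variable the expectation is the Bochner integral. -/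
theorem eExpectation_coe {Ω : Type*} [MeasurableSpace Ω] {P : Measure Ω} {f : Ω → ℝ}
    (hf : Integrable f P) :
    eExpectation P (fun ω => (f ω : EReal)) = ((∫ ω, f ω ∂P : ℝ) : EReal) := by
  have h1 := lintegral_ofReal_ne_top hf
  have h2 : ∫⁻ ω, ENNReal.ofReal (-f ω) ∂P ≠ ∞ := lintegral_ofReal_ne_top hf.neg
  rw [integral_eq_lintegral_pos_part_sub_lintegral_neg_part hf, EReal.coe_sub,
    EReal.coe_ennreal_toReal h1, EReal.coe_ennreal_toReal h2]
  rfl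

/-- The negative part is `∞` on a space of mass one, so the expectation is `0 - ∞`. -/
theorem width_empty {d : ℕ} {Ω : Type*} [MeasurableSpace Ω] (P : Measure Ω)
    [IsProbabilityMeasure P] (η : Ω → EuclideanSpace ℝ (Fin d)) : width P η ∅ = ⊥ := by
  simp [width, eExpectation, eMaxInner]

/-- Submodularity of the expected maximum of extended-real random variables whose negative parts
have finite integral. -/
theorem eExpectation_max_add_le {Ω : Type*} [MeasurableSpace Ω] {P : Measure Ω}
    {f g h : Ω → EReal} (hf : AEMeasurable f P) (hg : AEMeasurable g P)
    (hhf : ∀ ω, h ω ≤ f ω) (hhg : ∀ ω, h ω ≤ g ω) (hh : ∫⁻ ω, (-h ω).toENNReal ∂P ≠ ∞) :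
    eExpectation P (fun ω => max (f ω) (g ω)) + eExpectation P h ≤
      eExpectation P f + eExpectation P g := by
  have hmono : ∀ {u v : Ω → EReal}, (∀ ω, u ω ≤ v ω) →
      ∫⁻ ω, (-v ω).toENNReal ∂P ≤ ∫⁻ ω, (-u ω).toENNReal ∂P := fun huv =>
    lintegral_mono fun ω => EReal.toENNReal_monotone (EReal.neg_le_neg_iff.2 (huv ω))
  have hfin : ∀ {v : Ω → EReal}, (∀ ω, h ω ≤ v ω) → ∫⁻ ω, (-v ω).toENNReal ∂P ≠ ∞ :=
    fun hv => ((hmono hv).trans_lt (lt_top_iff_ne_top.2 hh)).ne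
  have hmax : ∀ ω, h ω ≤ max (f ω) (g ω) := fun ω => (hhf ω).trans (le_max_left _ _)
  have hmin : ∀ ω, h ω ≤ min (f ω) (g ω) := fun ω => le_min (hhf ω) (hhg ω)
  -- The identity max + min = sum is used separately for positive and negative parts, where all
  -- terms are nonnegative and nothing is subtracted.
  have hpos : ∫⁻ ω, (max (f ω) (g ω)).toENNReal ∂P + ∫⁻ ω, (min (f ω) (g ω)).toENNReal ∂P =
      ∫⁻ ω, (f ω).toENNReal ∂P + ∫⁻ ω, (g ω).toENNReal ∂P := by
    rw [← lintegral_add_left' (hf.max hg).ereal_toENNReal, ← lintegral_add_left' hf.ereal_toENNReal]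
    refine lintegral_congr fun ω => ?_
    rw [EReal.toENNReal_monotone.map_max, EReal.toENNReal_monotone.map_min, max_add_min]
  have hanti : Antitone fun u : EReal => (-u).toENNReal := fun _ _ huv =>
    EReal.toENNReal_monotone (EReal.neg_le_neg_iff.2 huv)
  have hneg : ∫⁻ ω, (-max (f ω) (g ω)).toENNReal ∂P + ∫⁻ ω, (-min (f ω) (g ω)).toENNReal ∂P =
      ∫⁻ ω, (-f ω).toENNReal ∂P + ∫⁻ ω, (-g ω).toENNReal ∂P := by
    have hm : ∀ {u : Ω → EReal}, AEMeasurable u P → AEMeasurable (fun ω => (-u ω).toENNReal) P :=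
      fun hu => hu.neg.ereal_toENNReal
    rw [← lintegral_add_left' (hm (hf.max hg)), ← lintegral_add_left' (hm hf)]
    refine lintegral_congr fun ω => ?_
    rw [hanti.map_max, hanti.map_min, min_add_max]
  have hadd : ∀ {u v : Ω → EReal}, (∀ ω, h ω ≤ u ω) →
      eExpectation P u + eExpectation P v =
      ((∫⁻ ω, (u ω).toENNReal ∂P + ∫⁻ ω, (v ω).toENNReal ∂P : ℝ≥0∞) : EReal) -
        ((∫⁻ ω, (-u ω).toENNReal ∂P + ∫⁻ ω, (-v ω).toENNReal ∂P : ℝ≥0∞) : EReal) := by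
    intro u v hu
    rw [EReal.coe_ennreal_add, EReal.coe_ennreal_add, EReal.add_sub_add_comm]
    · rfl
    · exact Or.inl (EReal.coe_ennreal_ne_bot _)
    · exact Or.inl (EReal.coe_ennreal_eq_top_iff.not.2 (hfin hu))
  calc eExpectation P (fun ω => max (f ω) (g ω)) + eExpectation P h
      ≤ eExpectation P (fun ω => max (f ω) (g ω)) + eExpectation P (fun ω => min (f ω) (g ω)) := by
        gcongr
        exact eExpectation_mono P hmin
    _ = eExpectation P f + eExpectation P g := by
        rw [hadd hmax, hadd hhf, hpos, hneg]

theorem lintegral_neg_eMaxInner_ne_top {d : ℕ} {Ω : Type*} [MeasurableSpace Ω] {P : Measure Ω}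
    {η : Ω → EuclideanSpace ℝ (Fin d)} (hη : Integrable η P)
    {S : Set (EuclideanSpace ℝ (Fin d))} (hS : S.Nonempty) :
    ∫⁻ ω, (-eMaxInner S (η ω)).toENNReal ∂P ≠ ∞ := by
  obtain ⟨s, hs⟩ := hS
  refine ((lintegral_mono fun ω => EReal.toENNReal_monotone
    (EReal.neg_le_neg_iff.2 (inner_le_eMaxInner hs (η ω)))).trans_lt (lt_top_iff_ne_top.2 ?_)).ne
  exact lintegral_ofReal_ne_top (hη.const_inner s).neg

theorem width_nonneg {d : ℕ} {Ω : Type*} [MeasurableSpace Ω] {P : Measure Ω}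
    {η : Ω → EuclideanSpace ℝ (Fin d)} (hη : Integrable η P) (hmean : ∫ ω, η ω ∂P = 0)
    {S : Set (EuclideanSpace ℝ (Fin d))} (hS : S.Nonempty) : 0 ≤ width P η S := by
  obtain ⟨s, hs⟩ := hS
  calc (0 : EReal) = eExpectation P fun ω => ((inner ℝ s (η ω) : ℝ) : EReal) := by
        rw [eExpectation_coe (hη.const_inner s), integral_inner hη, hmean, inner_zero_right,
          EReal.coe_zero]
    _ ≤ width P η S := eExpectation_mono P fun ω => inner_le_eMaxInner hs (η ω)

theorem width_monotone {d : ℕ} {Ω : Type*} [MeasurableSpace Ω] (P : Measure Ω)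
    (η : Ω → EuclideanSpace ℝ (Fin d)) : Monotone (width P η) :=
  fun _ _ h => eExpectation_mono P fun ω => eMaxInner_mono h (η ω)

theorem width_isSubmodular {d : ℕ} {Ω : Type*} [MeasurableSpace Ω] {P : Measure Ω}
    [IsProbabilityMeasure P] {η : Ω → EuclideanSpace ℝ (Fin d)} (hη : Integrable η P) :
    IsSubmodular (width P η) := by
  intro S T
  rcases (S ∩ T).eq_empty_or_nonempty with h | h
  -- For disjoint sets the left side is `-∞`, by the convention for `∞ + (-∞)`.
  · rw [h, width_empty, EReal.add_bot]
    exact bot_le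
  · have hm : ∀ U, AEMeasurable (fun ω => eMaxInner U (η ω)) P := fun U =>
      (measurable_eMaxInner U).comp_aemeasurable hη.aemeasurable
    have := eExpectation_max_add_le (hm S) (hm T)
      (fun ω => eMaxInner_mono (Set.inter_subset_left (s := S) (t := T)) (η ω))
      (fun ω => eMaxInner_mono Set.inter_subset_right (η ω)) (lintegral_neg_eMaxInner_ne_top hη h)
    simp only [← eMaxInner_union] at this
    exact this

/-! ### Bounded sets. -/

theorem bddAbove_norm_image {E : Type*} [SeminormedAddCommGroup E] {S : Set E}
    (hb : Bornology.IsBounded S) : BddAbove ((fun s => ‖s‖) '' S) := by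
  obtain ⟨C, hC⟩ := hb.exists_norm_le
  exact ⟨C, by rintro _ ⟨s, hs, rfl⟩; exact hC s hs⟩

theorem norm_le_normRadius {d : ℕ} {S : Set (EuclideanSpace ℝ (Fin d))}
    (hb : Bornology.IsBounded S) {s : EuclideanSpace ℝ (Fin d)} (hs : s ∈ S) :
    ‖s‖ ≤ normRadius S :=
  le_csSup (bddAbove_norm_image hb) ⟨s, hs, rfl⟩

theorem normRadius_nonneg {d : ℕ} (S : Set (EuclideanSpace ℝ (Fin d))) : 0 ≤ normRadius S :=
  Real.sSup_nonneg (by rintro _ ⟨s, -, rfl⟩; exact norm_nonneg s)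

theorem bddAbove_inner_image {d : ℕ} {S : Set (EuclideanSpace ℝ (Fin d))}
    (hb : Bornology.IsBounded S) (x : EuclideanSpace ℝ (Fin d)) :
    BddAbove ((fun s => (inner ℝ s x : ℝ)) '' S) := by
  refine ⟨normRadius S * ‖x‖, ?_⟩
  rintro _ ⟨s, hs, rfl⟩
  exact (real_inner_le_norm s x).trans
    (mul_le_mul_of_nonneg_right (norm_le_normRadius hb hs) (norm_nonneg x))

theorem eMaxInner_eq_coe_maxInner {d : ℕ} {S : Set (EuclideanSpace ℝ (Fin d))}
    (hS : S.Nonempty) (hb : Bornology.IsBounded S) (x : EuclideanSpace ℝ (Fin d)) :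
    eMaxInner S x = (maxInner S x : EReal) := by
  refine le_antisymm (iSup₂_le fun s hs => ?_) ?_
  · exact EReal.coe_le_coe_iff.2 (le_csSup (bddAbove_inner_image hb x) ⟨s, hs, rfl⟩)
  · obtain ⟨s₀, hs₀⟩ := hS
    induction h : eMaxInner S x with
    | bot => exact absurd (h ▸ inner_le_eMaxInner hs₀ x) (by simp)
    | top => exact le_top
    | coe r =>
      refine EReal.coe_le_coe_iff.2 (csSup_le ⟨_, s₀, hs₀, rfl⟩ ?_)
      rintro _ ⟨s, hs, rfl⟩
      exact EReal.coe_le_coe_iff.1 (h ▸ inner_le_eMaxInner hs x)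

/-- Each `⟨s, ·⟩` has Lipschitz constant `‖s‖`, and a finite supremum of functions keeps a common
constant. -/
theorem maxInner_lipschitzWith {d : ℕ} {S : Set (EuclideanSpace ℝ (Fin d))}
    (hS : S.Nonempty) (hb : Bornology.IsBounded S) :
    LipschitzWith ⟨normRadius S, normRadius_nonneg S⟩ (maxInner S) := by
  refine LipschitzWith.of_le_add_mul _ fun x y => csSup_le (hS.image _) ?_
  rintro _ ⟨s, hs, rfl⟩
  have h1 : (inner ℝ s y : ℝ) ≤ maxInner S y := le_csSup (bddAbove_inner_image hb y) ⟨s, hs, rfl⟩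
  have h2 : (inner ℝ s (x - y) : ℝ) ≤ normRadius S * ‖x - y‖ := (real_inner_le_norm _ _).trans
    (mul_le_mul_of_nonneg_right (norm_le_normRadius hb hs) (norm_nonneg _))
  rw [inner_sub_right] at h2
  rw [dist_eq_norm]
  change _ ≤ maxInner S y + normRadius S * _
  linarith

theorem maxInner_zero {d : ℕ} {S : Set (EuclideanSpace ℝ (Fin d))} (hS : S.Nonempty) :
    maxInner S 0 = 0 := by
  simp [maxInner, hS]

theorem integrable_maxInner {d : ℕ} {Ω : Type*} [MeasurableSpace Ω] {P : Measure Ω}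
    {η : Ω → EuclideanSpace ℝ (Fin d)} (hη : Integrable η P)
    {S : Set (EuclideanSpace ℝ (Fin d))} (hS : S.Nonempty) (hb : Bornology.IsBounded S) :
    Integrable (fun ω => maxInner S (η ω)) P := by
  have hL := maxInner_lipschitzWith hS hb
  -- The maximum vanishes at `0`, so the Lipschitz bound gives the integrable majorant `D(S) ‖η‖`.
  refine (hη.norm.const_mul (normRadius S)).mono'
    (hL.continuous.comp_aestronglyMeasurable hη.aestronglyMeasurable) (ae_of_all _ fun ω => ?_)
  have h := hL.dist_le_mul (η ω) 0
  rwa [maxInner_zero hS, dist_zero_right, dist_zero_right] at h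

theorem width_eq_integral_maxInner {d : ℕ} {Ω : Type*} [MeasurableSpace Ω] {P : Measure Ω}
    {η : Ω → EuclideanSpace ℝ (Fin d)} (hη : Integrable η P)
    {S : Set (EuclideanSpace ℝ (Fin d))} (hS : S.Nonempty) (hb : Bornology.IsBounded S) :
    width P η S = ((∫ ω, maxInner S (η ω) ∂P : ℝ) : EReal) := by
  rw [← eExpectation_coe (integrable_maxInner hη hS hb)]
  simp only [width, eMaxInner_eq_coe_maxInner hS hb]

/-! ### Concentration of empirical means. -/

/-- Two-sided tail bound for a sub-Gaussian random variable. -/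
theorem HasSubgaussianMGF.measureReal_abs_ge_le {Ω : Type*} [MeasurableSpace Ω] {P : Measure Ω}
    [IsFiniteMeasure P] {X : Ω → ℝ} {c : NNReal} (hX : HasSubgaussianMGF X c P) {ε : ℝ}
    (hε : 0 ≤ ε) : P.real {ω | ε ≤ |X ω|} ≤ 2 * Real.exp (-ε ^ 2 / (2 * c)) := by
  have hsub : {ω | ε ≤ |X ω|} ⊆ {ω | ε ≤ X ω} ∪ {ω | ε ≤ (-X) ω} := fun ω hω =>
    (le_abs (a := ε) (b := X ω)).1 hω
  have h := (measureReal_mono (μ := P) hsub).trans (measureReal_union_le _ _)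
  linarith [hX.measure_ge_le hε, hX.neg.measure_ge_le hε]

/-- Concentration of the empirical mean of a Lipschitz function of independent standard Gaussian
vectors. -/
theorem LipschitzWith.empirical_mean_stdGaussian {d : ℕ} {F : EuclideanSpace ℝ (Fin d) → ℝ}
    {K : NNReal} (hF : LipschitzWith K F) {Ω : Type*} [MeasurableSpace Ω] (P : Measure Ω)
    [IsProbabilityMeasure P] {k : ℕ} (hk : 0 < k) {ηs : Fin k → Ω → EuclideanSpace ℝ (Fin d)}
    (hind : iIndepFun ηs P)
    (hlaw : ∀ j, HasLaw (ηs j) (stdGaussian (EuclideanSpace ℝ (Fin d))) P)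
    {δ : ℝ} (hδ : 0 < δ) (hδ1 : δ ≤ 1) :
    1 - δ ≤ P.real {ω | |(1 / (k : ℝ)) * ∑ j, F (ηs j ω) -
      ∫ x, F x ∂stdGaussian (EuclideanSpace ℝ (Fin d))| ≤
        K * √(2 * Real.log (2 / δ) / k)} := by
  have hk' : (0 : ℝ) < k := Nat.cast_pos.2 hk
  set m := ∫ x, F x ∂stdGaussian (EuclideanSpace ℝ (Fin d)) with hm
  have havg : ∀ ω, (1 / (k : ℝ)) * ∑ j, F (ηs j ω) - m =
      (1 / (k : ℝ)) * ∑ j, (F (ηs j ω) - m) := by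
    intro ω
    rw [Finset.sum_sub_distrib]
    simp only [Finset.sum_const, Finset.card_univ, Fintype.card_fin, nsmul_eq_mul]
    field_simp
  simp only [havg]
  -- The tail exponent divides by `K²`; for `K = 0` the function is constant and the deviation is
  -- zero.
  rcases eq_or_ne K 0 with rfl | hK
  · have hconst : ∀ x, F x = F 0 := fun x => by
      have := hF.dist_le_mul x 0
      rw [NNReal.coe_zero, zero_mul] at this
      exact dist_le_zero.1 this
    have hmF : m = F 0 := by
      rw [hm, integral_congr_ae (ae_of_all _ hconst), integral_const]
      simp
    have hzero : ∀ j ω, F (ηs j ω) - m = 0 := fun j ω => by rw [hconst, hmF, sub_self]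
    simp only [hzero]
    simp [hδ.le]
  have hK' : (0 : ℝ) < K := NNReal.coe_pos.2 (pos_iff_ne_zero.2 hK)
  have hFm : Measurable F := hF.continuous.measurable
  have hsub : ∀ j ∈ Finset.univ, HasSubgaussianMGF (fun ω => F (ηs j ω) - m) (K ^ 2) P := by
    intro j _
    refine HasSubgaussianMGF.of_map (X := fun x => F x - m) (hlaw j).aemeasurable ?_
    rw [(hlaw j).map_eq]
    exact hF.hasSubgaussianMGF_stdGaussian
  have hind' : iIndepFun (fun j ω => F (ηs j ω) - m) P :=
    hind.comp (fun _ x => F x - m) fun _ => hFm.sub_const m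
  have hlog : 0 ≤ Real.log (2 / δ) := Real.log_nonneg (by rw [le_div_iff₀ hδ]; linarith)
  set r := √(2 * Real.log (2 / δ) / k)
  -- The sum has proxy `k K²`, and `ε = k K r` solves `2 exp (-ε² / (2 k K²)) = δ`.
  have htail := HasSubgaussianMGF.measureReal_abs_ge_le
    (HasSubgaussianMGF.sum_of_iIndepFun hind' hsub) (ε := k * (K * r)) (by positivity)
  have hexp : 2 * Real.exp (-(k * (K * r)) ^ 2 /
      (2 * ((∑ _j : Fin k, K ^ 2 : NNReal) : ℝ))) = δ := by
    have hr : r ^ 2 = 2 * Real.log (2 / δ) / k := Real.sq_sqrt (by positivity)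
    have e : -(k * (K * r)) ^ 2 / (2 * ((∑ _j : Fin k, K ^ 2 : NNReal) : ℝ)) =
        -Real.log (2 / δ) := by
      simp only [Finset.sum_const, Finset.card_univ, Fintype.card_fin, nsmul_eq_mul]
      push_cast
      rw [mul_pow, mul_pow, hr]
      field_simp
    rw [e, Real.exp_neg, Real.exp_log (by positivity)]
    field_simp
  rw [hexp] at htail
  set A := {ω | |(1 / (k : ℝ)) * ∑ j, (F (ηs j ω) - m)| ≤ K * r}
  have hcompl : Aᶜ ⊆ {ω | k * (K * r) ≤ |∑ j, (F (ηs j ω) - m)|} := by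
    intro ω hω
    have h : K * r < |(1 / (k : ℝ)) * ∑ j, (F (ηs j ω) - m)| := not_le.1 hω
    rw [abs_mul, abs_of_pos (one_div_pos.2 hk'), one_div, inv_mul_eq_div, lt_div_iff₀ hk'] at h
    change k * (K * r) ≤ _
    linarith
  -- Subadditivity is enough, so `A` need not be measurable.
  have h1 : (1 : ℝ) ≤ P.real A + P.real Aᶜ := by
    rw [← probReal_univ (μ := P), ← Set.union_compl_self A]
    exact measureReal_union_le _ _
  linarith [measureReal_mono (μ := P) hcompl]

/-- `‖s‖` is the distance between two points of the convex hull, which has the same diameter as `S`.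
-/
theorem normRadius_le_diam {d : ℕ} {S : Set (EuclideanSpace ℝ (Fin d))} (hS : S.Nonempty)
    (hb : Bornology.IsBounded S) (h0 : (0 : EuclideanSpace ℝ (Fin d)) ∈ convexHull ℝ S) :
    normRadius S ≤ Metric.diam S := by
  refine csSup_le (hS.image _) ?_
  rintro _ ⟨s, hs, rfl⟩
  rw [← convexHull_diam S]
  simpa using Metric.dist_le_diam_of_mem (isBounded_convexHull.2 hb) (subset_convexHull ℝ S hs) h0

theorem lemma3 {d : ℕ} {Ω : Type*} [MeasurableSpace Ω] (P : Measure Ω) [IsProbabilityMeasure P]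
    (η : Ω → EuclideanSpace ℝ (Fin d)) (hη : Integrable η P) (hmean : ∫ ω, η ω ∂P = 0) :
    -- the width is nonnegative, monotone and submodular
    (∀ S : Set (EuclideanSpace ℝ (Fin d)), S.Nonempty → 0 ≤ width P η S) ∧
    Monotone (width P η) ∧
    IsSubmodular (width P η) ∧
    -- on nonempty bounded sets it is a finite, ordinary expectation
    (∀ S : Set (EuclideanSpace ℝ (Fin d)), S.Nonempty → Bornology.IsBounded S →
      Integrable (fun ω => maxInner S (η ω)) P ∧
      width P η S = ((∫ ω, maxInner S (η ω) ∂P : ℝ) : EReal)) ∧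
    -- concentration of the empirical average of Gaussian samples
    (HasLaw η (stdGaussian (EuclideanSpace ℝ (Fin d))) P →
      ∀ {Ω' : Type*} [MeasurableSpace Ω'] (P' : Measure Ω') [IsProbabilityMeasure P']
        (k : ℕ) (_ : 0 < k) (ηs : Fin k → Ω' → EuclideanSpace ℝ (Fin d))
        (_ : iIndepFun ηs P')
        (_ : ∀ j, HasLaw (ηs j) (stdGaussian (EuclideanSpace ℝ (Fin d))) P')
        (S : Set (EuclideanSpace ℝ (Fin d))) (_ : S.Nonempty) (_ : Bornology.IsBounded S)
        (δ : ℝ) (_ : 0 < δ) (_ : δ ≤ 1),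
        1 - δ ≤ P'.real {ω |
          |(1 / (k : ℝ)) * ∑ j, maxInner S (ηs j ω) - ∫ ω', maxInner S (η ω') ∂P| ≤
            normRadius S * Real.sqrt (2 * Real.log (2 / δ) / k)} ∧
        ((0 : EuclideanSpace ℝ (Fin d)) ∈ convexHull ℝ S →
          1 - δ ≤ P'.real {ω |
            |(1 / (k : ℝ)) * ∑ j, maxInner S (ηs j ω) - ∫ ω', maxInner S (η ω') ∂P| ≤
              Metric.diam S * Real.sqrt (2 * Real.log (2 / δ) / k)})) := by

  refine ⟨fun S => width_nonneg hη hmean, width_monotone P η, width_isSubmodular hη,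
    fun S hS hb => ⟨integrable_maxInner hη hS hb, width_eq_integral_maxInner hη hS hb⟩, ?_⟩
  intro hlaw Ω' _ P' _ k hk ηs hind hlaws S hS hb δ hδ hδ1
  have hL := maxInner_lipschitzWith hS hb
  have hmain := hL.empirical_mean_stdGaussian P' hk hind hlaws hδ hδ1
  -- The law of `η` turns the Gaussian integral into the expectation under `P`.
  rw [← hlaw.integral_comp hL.continuous.aestronglyMeasurable] at hmain
  refine ⟨hmain, fun h0 => hmain.trans (measureReal_mono fun ω hω => ?_)⟩
  exact le_trans hω (mul_le_mul_of_nonneg_right (normRadius_le_diam hS hb h0) (Real.sqrt_nonneg _))
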